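/- Let $U=(U_n)_{n\ge 0}$ be a positional numeration system, i.e., a strictly increasing sequence of integers with $U_0=1$ such that the quotients $U_{n+1}/U_n$ are bounded. For $x\in\mathbb N$, let $\mathrm{rep}_U(x)=a_{m-1}\cdots a_0$ be its greedy representation: $m$ is the least integer with $x<U_m$, $r_m=x$, and $a_n=\lfloor r_{n+1}/U_n\rfloor$, $r_n=r_{n+1}-a_nU_n$ for $n=m-1,\ldots,0$. The numeration language is $L_U=0^*\,\mathrm{rep}_U(\mathbb N)$, a language over the finite alphabet $\{0,\ldots,\sup_{n}\lceil U_{n+1}/U_n\rceil-1\}$. Suppose that $U$ has a dominant root $\beta\ge 1$, i.e., $\lim_{n\to\infty}U_{n+1}/U_n=\beta$. Let $d_\beta(1)=t_0t_1t_2\cdots$ be the greedy expansion of $1$ in base $\beta$: $\rho_0=1$, $t_n=\lfloor\beta\rho_n\rfloor$ and $\rho_{n+1}=\beta\rho_n-t_n$ (so $d_1(1)=10^\omega$). Suppose that $d_\beta(1)$ is finite of length $\ell$, i.e., $t_{\ell-1}\neq 0$ and $t_n=0$ for all $n\ge \ell$. For $n\ge\ell$, put \[ \Delta_n=U_n-\sum_{k=1}^{\ell}t_{k-1}U_{n-k}.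 \] Then the following hold. 1. If $L_U$ is regular, then the sequence $\Delta=(\Delta_n)_{n\ge\ell}$ is ultimately periodic. 2. Suppose that $\Delta$ is ultimately periodic with a preperiod $N\ge\ell$ and a period $M=M'\ell$ with $M'\ge 1$, i.e., $\Delta_{n+M}=\Delta_n$ for all $n\ge N$ ($N$ and $M$ need not be minimal). Then $L_U$ is regular if and only if \[ \sum_{j=0}^{M'-1}\Delta_{n-j\ell}\ge 0\qquad\text{for all } n\in\{N+M-\ell,\ldots,N+M-1\}. \] -/

import Mathlib

open Filter Topology

namespace PosNum

/-- A positional numeration system: a (strictly) increasing sequence of integers with `U 0 = 1`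
(hence with values in `ℕ`) whose quotients of consecutive terms are bounded. -/
structure IsPositionalSystem (U : ℕ → ℕ) : Prop where
  strictMono : StrictMono U
  zero : U 0 = 1
  bddAbove_quotients : BddAbove (Set.range fun n => (U (n + 1) : ℝ) / (U n : ℝ))

/-- `greedyDigits U n r` is the word `a_{n-1} ⋯ a_0` (most significant digit first) computed by the
greedy algorithm started at `r_n = r`: `a_k = ⌊r_{k+1} / U_k⌋`, `r_k = r_{k+1} - a_k U_k`. -/
def greedyDigits (U : ℕ → ℕ) : ℕ → ℕ → List ℕ
  | 0, _ => []
  | n + 1, r => (r / U n) :: greedyDigits U n (r - (r / U n) * U n)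

/-- The greedy representation `rep_U(x)`, started at the least `ℓ` with `x < U ℓ`. -/
noncomputable def rep (U : ℕ → ℕ) (x : ℕ) : List ℕ :=
  greedyDigits U (sInf {l : ℕ | x < U l}) x

/-- The words `0^k rep_U(x)`, as words over `ℕ`. -/
def paddedReps (U : ℕ → ℕ) : Set (List ℕ) :=
  {w | ∃ k x : ℕ, w = List.replicate k 0 ++ rep U x}

/-- The size of the numeration alphabet `A_U = {0, …, sup_n ⌈U_{n+1} / U_n⌉ - 1}`. -/
noncomputable def alphabetSize (U : ℕ → ℕ) : ℕ :=
  ⨆ n : ℕ, ⌈(U (n + 1) : ℝ) / (U n : ℝ)⌉₊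

/-- The numeration language `L_U = 0^* rep_U(ℕ)` over the finite alphabet `A_U`, whose letters are
the elements of `Fin (alphabetSize U)`. No word of `0^* rep_U(ℕ)` is lost in this way, see
`paddedReps_eq_image`. -/
def numerationLanguage (U : ℕ → ℕ) : Language (Fin (alphabetSize U)) :=
  {w : List (Fin (alphabetSize U)) | w.map Fin.val ∈ paddedReps U}

theorem lt_alphabetSize {U : ℕ → ℕ} (hU : IsPositionalSystem U) {n r : ℕ} (hr : r < U (n + 1)) :
    r / U n < alphabetSize U := by
  have hpos : 0 < U n := by
    have h1 := hU.strictMono.monotone (Nat.zero_le n)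
    rw [hU.zero] at h1
    omega
  have hposR : (0 : ℝ) < U n := by exact_mod_cast hpos
  obtain ⟨C, hC⟩ := hU.bddAbove_quotients
  have hb : BddAbove (Set.range fun n : ℕ => ⌈(U (n + 1) : ℝ) / (U n : ℝ)⌉₊) := by
    refine ⟨⌈C⌉₊, ?_⟩
    rintro _ ⟨m, rfl⟩
    exact Nat.ceil_mono (hC ⟨m, rfl⟩)
  refine lt_of_lt_of_le ?_ (le_ciSup hb n)
  rw [Nat.lt_ceil, lt_div_iff₀ hposR]
  exact_mod_cast lt_of_le_of_lt (Nat.div_mul_le_self r (U n)) hr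

theorem greedyDigits_lt {U : ℕ → ℕ} (hU : IsPositionalSystem U) (n r : ℕ) (hr : r < U n) :
    ∀ a ∈ greedyDigits U n r, a < alphabetSize U := by
  induction n generalizing r with
  | zero => simp [greedyDigits]
  | succ n ih =>
    have hpos : 0 < U n := by
      have h1 := hU.strictMono.monotone (Nat.zero_le n)
      rw [hU.zero] at h1
      omega
    intro a ha
    rw [greedyDigits, List.mem_cons] at ha
    rcases ha with rfl | ha
    · exact lt_alphabetSize hU hr
    · refine ih _ ?_ a ha
      have h2 := Nat.mod_lt r hpos
      rwa [Nat.mod_eq_sub_div_mul] at h2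

theorem paddedReps_eq_image {U : ℕ → ℕ} (hU : IsPositionalSystem U) :
    paddedReps U =
      (fun w : List (Fin (alphabetSize U)) => w.map Fin.val) ''
        {w | w ∈ numerationLanguage U} := by
  ext v
  constructor
  · intro hv
    have hlt : ∀ a ∈ v, a < alphabetSize U := by
      obtain ⟨k, x, rfl⟩ := hv
      intro a ha
      rw [List.mem_append] at ha
      rcases ha with ha | ha
      · rw [List.eq_of_mem_replicate ha]
        have h0 : 0 < U (0 + 1) := lt_of_le_of_lt (Nat.zero_le _) (hU.strictMono (Nat.lt_succ_self 0))
        simpa using lt_alphabetSize hU h0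
      · refine greedyDigits_lt hU _ x ?_ a ha
        have hne : {l : ℕ | x < U l}.Nonempty :=
          ⟨x + 1, lt_of_lt_of_le (Nat.lt_succ_self x) hU.strictMono.le_apply⟩
        exact Nat.sInf_mem hne
    have hmap : (v.pmap (fun a h => (⟨a, h⟩ : Fin (alphabetSize U))) hlt).map
        Fin.val = v := by
      rw [List.map_pmap]
      simp
    refine ⟨_, ?_, hmap⟩
    change _ ∈ paddedReps U
    rw [hmap]
    exact hv
  · rintro ⟨w, hw, rfl⟩
    exact hw

/-- `U` has dominant root `β`. -/
def HasDominantRoot (U : ℕ → ℕ) (β : ℝ) : Prop :=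
  Tendsto (fun n => (U (n + 1) : ℝ) / (U n : ℝ)) atTop (𝓝 β)

/-- The remainders of the greedy algorithm in base `β` started at `1`:
`r_0 = 1`, `r_{n+1} = β r_n - ⌊β r_n⌋`. -/
noncomputable def remainder (β : ℝ) : ℕ → ℝ
  | 0 => 1
  | n + 1 => β * remainder β n - (⌊β * remainder β n⌋₊ : ℝ)

/-- The digits `t_n = ⌊β r_n⌋` of the greedy expansion `d_β(1) = t_0 t_1 t_2 ⋯`.
For `β = 1` this gives `d_1(1) = 1 0^ω`. -/
noncomputable def digit (β : ℝ) (n : ℕ) : ℕ :=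
  ⌊β * remainder β n⌋₊

/-- The infinite word `a` is finite of length `l`, i.e. it ends in a tail of zeros and `l` is the
length of its prefix up to the last nonzero digit. -/
def IsFiniteOfLength (a : ℕ → ℕ) (l : ℕ) : Prop :=
  IsLeast {m : ℕ | ∀ n, m ≤ n → a n = 0} l

/-- `Δ_n = U_n - ∑_{k=1}^{l} t_{k-1} U_{n-k}`, relevant for `n ≥ l` only. -/
noncomputable def Delta (U : ℕ → ℕ) (β : ℝ) (l n : ℕ) : ℤ :=
  (U n : ℤ) - ∑ k ∈ Finset.Icc 1 l, (digit β (k - 1) : ℤ) * (U (n - k) : ℤ)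

/-- `s` is ultimately periodic with preperiod `N` and period `M` (neither need be minimal). -/
def HasPreperiodPeriod (s : ℕ → ℤ) (N M : ℕ) : Prop :=
  0 < M ∧ ∀ n, N ≤ n → s (n + M) = s n

end PosNum

/-! Write d = t_0⋯t_{l-1}, let q be d with its last digit lowered by 1, and put S_s(m) = Δ_{m+l} +
Δ_{m+2l} + ⋯ + Δ_{m+sl}. A word belongs to the language iff each nonempty suffix w has value below
U_{|w|} (`mem_paddedReps_iff`). Since U has dominant root β and the remainders after the first are <
1, proper suffixes of a block are harmless in front of a long tail, and only whole blocks matter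
(`exists_isGreedy_block_iff`). For a greedy v of large length m, q^j v is greedy iff val v < U_m +
S_s(m) for all s ≤ j; if moreover val v is small compared with U_m, then d v is greedy iff val v <
Δ_{m+l}.

If the language is regular, two of the words d 0^k have the same continuations, which bounds Δ
above; two of the words q^j do as well, which forbids late new minima of s ↦ S_s(m) and so bounds Δ
below. Counting words of each length gives U, hence Δ, a monic integer recurrence, and a bounded
integer solution is ultimately periodic. A negative cycle sum would drive S_s(m) to -∞, against the
statement on minima.

Conversely, testing a suffix is a lexicographic comparison with the representation of U_n - 1. With
nonnegative cycle sums this word is either q^j d 0^a z with z of bounded length, or q^{M'} followed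
by the word for n - M (`exists_topWord_structure`). So its prefixes and suffixes are ultimately
periodic, and finitely many states suffice to read words from the right (`isRegular_of_topWord`). -/

namespace PosNum

/-! ### Greedy words and their values. -/

/-- The value of the word `w 0^i`. -/
def shiftVal (U : ℕ → ℕ) (i : ℕ) : List ℕ → ℕ
  | [] => 0
  | a :: w => a * U (i + w.length) + shiftVal U i w

/-- The value of a word. -/
def val (U : ℕ → ℕ) : List ℕ → ℕ
  | [] => 0
  | a :: w => a * U w.length + val U w

/-- Every nonempty suffix `s` of the word has value less than `U |s|`. -/
def IsGreedy (U : ℕ → ℕ) : List ℕ → Prop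
  | [] => True
  | a :: w => val U (a :: w) < U (w.length + 1) ∧ IsGreedy U w

theorem val_append (U : ℕ → ℕ) (u v : List ℕ) :
    val U (u ++ v) = shiftVal U v.length u + val U v := by
  induction u with
  | nil => simp [shiftVal]
  | cons a u ih =>
    simp only [List.cons_append, val, shiftVal, ih, List.length_append]
    rw [Nat.add_comm u.length]
    ring

theorem shiftVal_append (U : ℕ → ℕ) (i : ℕ) (u v : List ℕ) :
    shiftVal U i (u ++ v) = shiftVal U (i + v.length) u + shiftVal U i v := by
  induction u with
  | nil => simp [shiftVal]
  | cons a u ih =>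
    simp only [List.cons_append, shiftVal, ih, List.length_append]
    rw [show i + (u.length + v.length) = i + v.length + u.length by omega]
    ring

theorem shiftVal_replicate_zero (U : ℕ → ℕ) (i k : ℕ) :
    shiftVal U i (List.replicate k 0) = 0 := by
  induction k with
  | zero => rfl
  | succ k ih => simp [List.replicate_succ, shiftVal, ih]

theorem val_replicate_zero_append (U : ℕ → ℕ) (k : ℕ) (v : List ℕ) :
    val U (List.replicate k 0 ++ v) = val U v := by
  rw [val_append, shiftVal_replicate_zero, zero_add]

theorem IsPositionalSystem.pos {U : ℕ → ℕ} (hU : IsPositionalSystem U) (n : ℕ) : 0 < U n := by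
  have h1 := hU.strictMono.monotone (Nat.zero_le n)
  rw [hU.zero] at h1
  omega

theorem IsGreedy.val_lt {U : ℕ → ℕ} (hU : IsPositionalSystem U) {w : List ℕ}
    (hw : IsGreedy U w) : val U w < U w.length := by
  cases w with
  | nil => simpa [val] using hU.pos 0
  | cons a w => simpa using hw.1

theorem IsGreedy.of_append {U : ℕ → ℕ} {u v : List ℕ} (h : IsGreedy U (u ++ v)) :
    IsGreedy U v := by
  induction u with
  | nil => simpa using h
  | cons a u ih => exact ih h.2

theorem IsGreedy.replicate_zero_append {U : ℕ → ℕ} (hU : IsPositionalSystem U) {v : List ℕ}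
    (hv : IsGreedy U v) (k : ℕ) : IsGreedy U (List.replicate k 0 ++ v) := by
  induction k with
  | zero => simpa
  | succ k ih =>
    rw [List.replicate_succ, List.cons_append]
    refine ⟨?_, ih⟩
    have := ih.val_lt hU
    have h2 := hU.strictMono (Nat.lt_succ_self (List.replicate k 0 ++ v).length)
    simp only [val, zero_mul, zero_add]
    exact this.trans h2

theorem IsGreedy.append {U : ℕ → ℕ} {u v : List ℕ} (hv : IsGreedy U v)
    (h : ∀ k < u.length, shiftVal U v.length (u.drop k) + val U v <
      U (v.length + (u.length - k))) : IsGreedy U (u ++ v) := by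
  induction u with
  | nil => simpa
  | cons a u ih =>
    refine ⟨?_, ih fun k hk => ?_⟩
    · have := h 0 (by simp)
      change val U (a :: u ++ v) < U ((u ++ v).length + 1)
      rw [val_append]
      simpa [Nat.add_comm, Nat.add_left_comm, Nat.add_assoc] using this
    · have := h (k + 1) (by simpa using hk)
      simpa using this

theorem isGreedy_append_iff {U : ℕ → ℕ} {u v : List ℕ} (hv : IsGreedy U v) (hu : u ≠ [])
    (h : ∀ k, 1 ≤ k → k < u.length → shiftVal U v.length (u.drop k) + val U v <
      U (v.length + (u.length - k))) :
    IsGreedy U (u ++ v) ↔ shiftVal U v.length u + val U v < U (v.length + u.length) := by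
  cases u with
  | nil => exact absurd rfl hu
  | cons a u =>
    have h1 : IsGreedy U (u ++ v) := hv.append fun k hk => by
      have := h (k + 1) (by omega) (by simpa using hk)
      simpa using this
    have h2 : IsGreedy U (a :: u ++ v) ↔ val U (a :: u ++ v) < U ((u ++ v).length + 1) := by
      simp [IsGreedy, h1]
    rw [h2, val_append]
    simp [Nat.add_comm, Nat.add_assoc]

theorem length_greedyDigits (U : ℕ → ℕ) (n x : ℕ) : (greedyDigits U n x).length = n := by
  induction n generalizing x with
  | zero => rfl
  | succ n ih => simp [greedyDigits, ih]

theorem greedyDigits_spec {U : ℕ → ℕ} (hU : IsPositionalSystem U) {n x : ℕ} (hx : x < U n) :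
    IsGreedy U (greedyDigits U n x) ∧ val U (greedyDigits U n x) = x := by
  induction n generalizing x with
  | zero =>
    rw [hU.zero] at hx
    simp [greedyDigits, IsGreedy, val]
    omega
  | succ n ih =>
    have h2 := Nat.mod_lt x (hU.pos n)
    rw [Nat.mod_eq_sub_div_mul] at h2
    obtain ⟨h3, h4⟩ := ih h2
    have h5 : val U (greedyDigits U (n + 1) x) = x := by
      rw [greedyDigits, val, length_greedyDigits, h4]
      have := Nat.div_mul_le_self x (U n)
      omega
    refine ⟨?_, h5⟩
    rw [greedyDigits] at h5 ⊢
    refine ⟨?_, h3⟩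
    rw [h5, length_greedyDigits]
    exact hx

theorem IsGreedy.eq_greedyDigits {U : ℕ → ℕ} (hU : IsPositionalSystem U) {w : List ℕ}
    (hw : IsGreedy U w) : w = greedyDigits U w.length (val U w) := by
  induction w with
  | nil => rfl
  | cons a w ih =>
    have h1 := ih hw.2
    have h2 := hw.2.val_lt hU
    have h3 : val U (a :: w) / U w.length = a := by
      rw [val, Nat.mul_comm, Nat.mul_add_div (hU.pos _), Nat.div_eq_of_lt h2, add_zero]
    rw [List.length_cons, greedyDigits, h3, val, Nat.add_sub_cancel_left, ← h1]

theorem greedyDigits_eq_replicate_append {U : ℕ → ℕ} (hU : IsPositionalSystem U) {m x : ℕ}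
    (hx : x < U m) (k : ℕ) :
    greedyDigits U (k + m) x = List.replicate k 0 ++ greedyDigits U m x := by
  obtain ⟨h1, h2⟩ := greedyDigits_spec hU hx
  have h3 := (h1.replicate_zero_append hU k).eq_greedyDigits hU
  rw [val_replicate_zero_append, h2] at h3
  simpa [length_greedyDigits] using h3.symm

theorem mem_paddedReps_iff {U : ℕ → ℕ} (hU : IsPositionalSystem U) (w : List ℕ) :
    w ∈ paddedReps U ↔ IsGreedy U w := by
  have hne (x : ℕ) : {l : ℕ | x < U l}.Nonempty :=
    ⟨x + 1, lt_of_lt_of_le (Nat.lt_succ_self x) hU.strictMono.le_apply⟩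
  constructor
  · rintro ⟨k, x, rfl⟩
    exact (greedyDigits_spec hU (Nat.sInf_mem (hne x))).1.replicate_zero_append hU k
  · intro hw
    have h1 : sInf {l : ℕ | val U w < U l} ≤ w.length := Nat.sInf_le (hw.val_lt hU)
    obtain ⟨k, hk⟩ := Nat.exists_eq_add_of_le' h1
    refine ⟨k, val U w, ?_⟩
    rw [rep, ← greedyDigits_eq_replicate_append hU (Nat.sInf_mem (hne (val U w))), ← hk]
    exact hw.eq_greedyDigits hU

theorem mem_numerationLanguage_iff {U : ℕ → ℕ} (hU : IsPositionalSystem U)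
    (w : List (Fin (alphabetSize U))) :
    w ∈ numerationLanguage U ↔ IsGreedy U (w.map Fin.val) :=
  mem_paddedReps_iff hU _

theorem IsGreedy.digits_lt {U : ℕ → ℕ} (hU : IsPositionalSystem U) {w : List ℕ}
    (hw : IsGreedy U w) : ∀ a ∈ w, a < alphabetSize U := by
  rw [hw.eq_greedyDigits hU]
  exact greedyDigits_lt hU _ _ (hw.val_lt hU)

/-! ### Lexicographic comparison with maximal words, and a criterion for regularity. -/

/-- Greedy words of the same length are ordered by value as they are lexicographically. -/
theorem val_append_le_iff {U : ℕ → ℕ} (hU : IsPositionalSystem U) {u p s q : List ℕ}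
    (hlen : u.length = p.length) (hlen' : s.length = q.length)
    (hu : IsGreedy U (u ++ s).tail) (hp : IsGreedy U (p ++ q)) :
    val U (u ++ s) ≤ val U (p ++ q) ↔ u < p ∨ u = p ∧ val U s ≤ val U q := by
  induction u generalizing p with
  | nil =>
    obtain rfl : p = [] := by simpa using hlen.symm
    simp
  | cons a u ih =>
    cases p with
    | nil => simp at hlen
    | cons b p =>
      have hlen1 : u.length = p.length := by simpa using hlen
      have hu' : IsGreedy U (u ++ s) := by simpa using hu
      have hut : IsGreedy U (u ++ s).tail := by
        cases h : u ++ s with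
        | nil => trivial
        | cons c w => rw [h] at hu'; exact hu'.2
      have h1 := ih hlen1 hut hp.2
      have hl : (u ++ s).length = (p ++ q).length := by simp [hlen1, hlen']
      have h2 := hu'.val_lt hU
      have h3 := IsGreedy.val_lt hU hp.2
      change val U (p ++ q) < U (p ++ q).length at h3
      rw [hl] at h2
      simp only [List.cons_append, val, hl]
      rw [List.cons_lt_cons_iff, List.cons.injEq]
      rcases lt_trichotomy a b with hab | rfl | hab
      · have : (a + 1) * U (p ++ q).length ≤ b * U (p ++ q).length :=
          Nat.mul_le_mul_right _ hab
        rw [add_mul] at this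
        simp only [hab, true_or, iff_true]
        omega
      · simp only [lt_irrefl, true_and, false_or, Nat.add_le_add_iff_left, h1]
      · have : (b + 1) * U (p ++ q).length ≤ a * U (p ++ q).length :=
          Nat.mul_le_mul_right _ hab
        rw [add_mul] at this
        have h4 : ¬ a < b := by omega
        have h5 : a ≠ b := by omega
        simp only [h4, h5, false_and, or_self, iff_false]
        omega

/-- The greedy word of length `n` with the largest value. -/
def topWord (U : ℕ → ℕ) (n : ℕ) : List ℕ :=
  greedyDigits U n (U n - 1)

theorem length_topWord (U : ℕ → ℕ) (n : ℕ) : (topWord U n).length = n :=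
  length_greedyDigits U n _

theorem isGreedy_topWord {U : ℕ → ℕ} (hU : IsPositionalSystem U) (n : ℕ) :
    IsGreedy U (topWord U n) :=
  (greedyDigits_spec hU (Nat.sub_lt (hU.pos n) one_pos)).1

theorem val_topWord {U : ℕ → ℕ} (hU : IsPositionalSystem U) (n : ℕ) :
    val U (topWord U n) = U n - 1 :=
  (greedyDigits_spec hU (Nat.sub_lt (hU.pos n) one_pos)).2

theorem IsGreedy.eq_topWord {U : ℕ → ℕ} (hU : IsPositionalSystem U) {w : List ℕ} {n : ℕ}
    (hw : IsGreedy U w) (hn : w.length = n) (hv : val U w = U n - 1) : topWord U n = w := by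
  rw [hw.eq_greedyDigits hU, hn, hv, topWord]

/-- The map `r` is chosen before `f`, so it serves all functions with this preperiod and period at
once, whatever their codomain. -/
theorem exists_reduction {X p : ℕ} (hp : 0 < p) :
    ∃ r : ℕ → Fin (X + p), ∀ {β : Type} (f : ℕ → β), (∀ n, X ≤ n → f (n + p) = f n) →
      ∀ n, f n = f (r n) := by
  refine ⟨fun n => if h : n < X then ⟨n, by omega⟩ else
    ⟨X + (n - X) % p, Nat.add_lt_add_left (Nat.mod_lt _ hp) X⟩, fun f hf n => ?_⟩
  have key : ∀ a k, X ≤ a → f (a + k * p) = f a := by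
    intro a k ha
    induction k with
    | zero => simp
    | succ k ih => rw [Nat.succ_mul, ← Nat.add_assoc, hf _ (by omega), ih]
  dsimp only
  split_ifs with h
  · rfl
  · have := key (X + (n - X) % p) ((n - X) / p) (by omega)
    rw [← this]
    congr 1
    have := Nat.mod_add_div' (n - X) p
    omega

/-- The numeration language is regular as soon as the greedy words of largest value are ultimately
periodic, both in their leading and in their trailing digits. -/
theorem isRegular_of_topWord {U : ℕ → ℕ} (hU : IsPositionalSystem U) {p I X : ℕ} (hp : 0 < p)
    (hpre : ∀ i k, I ≤ i → (topWord U (k + (i + p))).take k = (topWord U (k + i)).take k)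
    (hsuf : ∀ i k, X ≤ k →
      (topWord U (k + p + i)).drop (k + p) = (topWord U (k + i)).drop k) :
    (numerationLanguage U).IsRegular := by
  classical
  obtain ⟨rI, hrI⟩ := exists_reduction (X := I) hp
  obtain ⟨rX, hrX⟩ := exists_reduction (X := X) hp
  let B : List ℕ → ℕ → Prop := fun s k =>
    val U s ≤ val U ((topWord U (k + s.length)).drop k)
  -- Finite state of a suffix `s`: is it greedy, its length up to periodicity, and how it compares
  -- with the ends of the maximal words. By `hsuf` the comparison depends on `k` only through `rX
  -- k`.
  let F : List (Fin (alphabetSize U)) → Prop × Fin (I + p) × (Fin (X + p) → Prop) :=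
    fun s => (IsGreedy U (s.map Fin.val), rI s.length, fun k => B (s.map Fin.val) k)
  have hcmp : ∀ (a : ℕ) (u s : List ℕ), IsGreedy U (u ++ s) →
      (IsGreedy U (a :: u ++ s) ↔
        (a :: u < (topWord U (u.length + 1 + s.length)).take (u.length + 1) ∨
          a :: u = (topWord U (u.length + 1 + s.length)).take (u.length + 1) ∧
            B s (u.length + 1))) := by
    intro a u s h
    set m := topWord U (u.length + 1 + s.length) with hm
    have hlm : m.length = u.length + 1 + s.length := length_topWord _ _
    have h1 : (a :: u).length = (m.take (u.length + 1)).length := by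
      simp [hlm]
    have h2 : s.length = (m.drop (u.length + 1)).length := by
      simp [hlm]
    have h3 : IsGreedy U (m.take (u.length + 1) ++ m.drop (u.length + 1)) := by
      rw [List.take_append_drop]
      exact isGreedy_topWord hU _
    -- The full word is not yet known to be greedy; greediness of its tail is enough for the
    -- comparison.
    have h4 := val_append_le_iff hU h1 h2 (by simpa using h) h3
    rw [List.take_append_drop, val_topWord hU] at h4
    rw [← h4, List.cons_append]
    have h5 : U ((u ++ s).length + 1) = U (u.length + 1 + s.length) := by
      congr 1
      simp only [List.length_append]
      omega
    have h6 := hU.pos (u.length + 1 + s.length)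
    simp only [IsGreedy, h, and_true, h5]
    omega
  have key : ∀ s s', F s = F s' → ∀ u : List ℕ,
      IsGreedy U (u ++ s.map Fin.val) ↔ IsGreedy U (u ++ s'.map Fin.val) := by
    intro s s' h u
    simp only [F, Prod.mk.injEq] at h
    obtain ⟨h1, h2, h3⟩ := h
    have hB : ∀ s : List ℕ, ∀ k, B s k = B s (rX k) := fun s =>
      hrX (B s) fun k hk => by simp only [B, hsuf _ k hk]
    have h4 : ∀ k, B (s.map Fin.val) k = B (s'.map Fin.val) k := fun k => by
      rw [hB, hB (s'.map _)]
      exact congrFun h3 _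
    have h5 : ∀ k, (topWord U (k + s.length)).take k = (topWord U (k + s'.length)).take k := by
      intro k
      rw [hrI (fun i => (topWord U (k + i)).take k) (fun i hi => hpre i k hi) s.length,
        hrI (fun i => (topWord U (k + i)).take k) (fun i hi => hpre i k hi) s'.length, h2]
    induction u with
    | nil => simp [h1]
    | cons a u ih =>
      by_cases hg : IsGreedy U (u ++ s.map Fin.val)
      · rw [hcmp a u _ hg, hcmp a u _ (ih.1 hg), h4]
        simp only [List.length_map, h5]
      · have hg' := mt ih.2 hg
        constructor
        · intro h; exact absurd h.2 hg
        · intro h; exact absurd h.2 hg'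
  -- `F` classifies suffixes, so the left quotients shown to be finite in number are those of the
  -- reversed language.
  refine Language.IsRegular.of_reverse (Language.IsRegular.of_finite_range_leftQuotient ?_)
  have hfac : Function.FactorsThrough (numerationLanguage U).reverse.leftQuotient
      (fun x => F x.reverse) := by
    intro x y hxy
    ext z
    rw [Language.mem_leftQuotient, Language.mem_leftQuotient, Language.mem_reverse,
      Language.mem_reverse, mem_numerationLanguage_iff hU, mem_numerationLanguage_iff hU]
    simpa using key _ _ hxy (z.reverse.map Fin.val)
  obtain ⟨g, hg⟩ := (Function.factorsThrough_iff _).1 hfac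
  rw [hg, Set.range_comp]
  exact (Set.toFinite _).image g

/-! ### Consequences of regularity: equal continuations and a linear recurrence. -/

/-- Among infinitely many words, two have the same continuations in a regular numeration
language. -/
theorem exists_lt_isGreedy_append_iff {U : ℕ → ℕ} (hU : IsPositionalSystem U)
    (hreg : (numerationLanguage U).IsRegular) (u : ℕ → List ℕ) :
    ∃ i j, i < j ∧ ∀ v, IsGreedy U (u i ++ v) ↔ IsGreedy U (u j ++ v) := by
  classical
  have hfin := hreg.finite_range_leftQuotient
  have := hfin.to_subtype
  let lift : ∀ w : List ℕ, (∀ a ∈ w, a < alphabetSize U) → List (Fin (alphabetSize U)) :=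
    fun w hw => w.pmap (fun a h => ⟨a, h⟩) hw
  have hlift : ∀ w hw, (lift w hw).map Fin.val = w := by
    intro w hw
    simp [lift, List.map_pmap]
  -- A word with a letter outside the alphabet has no greedy continuation, so all such words may
  -- share the value `none`.
  let F : ℕ → Option (Set.range (numerationLanguage U).leftQuotient) := fun i =>
    if h : ∀ a ∈ u i, a < alphabetSize U then some ⟨_, lift (u i) h, rfl⟩ else none
  have key : ∀ i j, F i = F j → ∀ v, IsGreedy U (u i ++ v) → IsGreedy U (u j ++ v) := by
    intro i j hij v hv
    have hd := hv.digits_lt hU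
    have hi : ∀ a ∈ u i, a < alphabetSize U := fun a ha => hd a (by simp [ha])
    have hv' : ∀ a ∈ v, a < alphabetSize U := fun a ha => hd a (by simp [ha])
    simp only [F, dif_pos hi] at hij
    by_cases hj : ∀ a ∈ u j, a < alphabetSize U
    · rw [dif_pos hj] at hij
      have h1 := congrArg Subtype.val (Option.some.inj hij)
      have h2 : lift v hv' ∈ (numerationLanguage U).leftQuotient (lift (u i) hi) := by
        rw [Language.mem_leftQuotient, mem_numerationLanguage_iff hU, List.map_append, hlift,
          hlift]
        exact hv
      change (numerationLanguage U).leftQuotient (lift (u i) hi) =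
        (numerationLanguage U).leftQuotient (lift (u j) hj) at h1
      rw [h1, Language.mem_leftQuotient, mem_numerationLanguage_iff hU, List.map_append, hlift,
        hlift] at h2
      exact h2
    · rw [dif_neg hj] at hij
      exact absurd hij (by simp)
  obtain ⟨i, j, hne, hij⟩ := Finite.exists_ne_map_eq_of_infinite F
  rcases lt_or_gt_of_ne hne with h | h
  · exact ⟨i, j, h, fun v => ⟨key i j hij v, key j i hij.symm v⟩⟩
  · exact ⟨j, i, h, fun v => ⟨key j i hij.symm v, key i j hij v⟩⟩

/-- The linear operator counting continuations in a deterministic automaton. -/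
def countOp {α σ : Type} [Fintype α] (M : DFA α σ) : (σ → ℤ) →ₗ[ℤ] (σ → ℤ) where
  toFun f q := ∑ a, f (M.step q a)
  map_add' f g := by ext q; simp [Finset.sum_add_distrib]
  map_smul' c f := by ext q; simp [Finset.mul_sum]

open Classical in
theorem countOp_pow_apply {α σ : Type} [Fintype α] (M : DFA α σ) (n : ℕ) (q : σ) :
    (countOp M ^ n) (fun q => if q ∈ M.accept then 1 else 0) q =
      ∑ w : Fin n → α, if M.evalFrom q (List.ofFn w) ∈ M.accept then 1 else 0 := by
  induction n generalizing q with
  | zero => simp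
  | succ n ih =>
    rw [pow_succ']
    change ∑ a, _ = _
    simp_rw [ih]
    rw [← Fintype.sum_equiv (Fin.consEquiv fun _ => α) (fun x : α × (Fin n → α) =>
      if M.evalFrom (M.step q x.1) (List.ofFn x.2) ∈ M.accept then (1 : ℤ) else 0) _
      (fun x => by simp [Fin.consEquiv, List.ofFn_succ]), Fintype.sum_prod_type]

open Classical in
-- The greedy algorithm is a bijection from the integers below `U n` to the greedy words of length
-- `n`.
theorem sum_ite_isGreedy {U : ℕ → ℕ} (hU : IsPositionalSystem U) (n : ℕ) :
    (∑ w : Fin n → Fin (alphabetSize U),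
      if IsGreedy U ((List.ofFn w).map Fin.val) then (1 : ℤ) else 0) = U n := by
  rw [Finset.sum_boole]
  norm_cast
  rw [← Finset.card_range (U n)]
  refine Finset.card_bij (fun w _ => val U ((List.ofFn w).map Fin.val)) ?_ ?_ ?_
  · intro w hw
    have := IsGreedy.val_lt hU (Finset.mem_filter.1 hw).2
    simpa using this
  · intro w hw w' hw' h
    have h1 := IsGreedy.eq_greedyDigits hU (Finset.mem_filter.1 hw).2
    have h2 := IsGreedy.eq_greedyDigits hU (Finset.mem_filter.1 hw').2
    rw [h] at h1
    simp only [List.length_map, List.length_ofFn] at h1 h2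
    exact List.ofFn_injective (List.map_injective_iff.2 Fin.val_injective (h1.trans h2.symm))
  · intro x hx
    have hx' : x < U n := by simpa using hx
    obtain ⟨h1, h2⟩ := greedyDigits_spec hU hx'
    have hl := length_greedyDigits U n x
    have hd := h1.digits_lt hU
    refine ⟨fun i => ⟨(greedyDigits U n x)[i]'(by omega), hd _ (List.getElem_mem _)⟩, ?_⟩
    have h3 : (List.ofFn fun i : Fin n => (⟨(greedyDigits U n x)[i]'(by omega),
        hd _ (List.getElem_mem _)⟩ : Fin (alphabetSize U))).map Fin.val =
          greedyDigits U n x := by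
      apply List.ext_getElem
      · simp [hl]
      · simp
    refine ⟨?_, ?_⟩
    · simp only [Finset.mem_filter, Finset.mem_univ, true_and]
      rw [h3]
      exact h1
    · rw [h3, h2]

/-- If the numeration language is regular, then `U` satisfies a linear recurrence over `ℤ`. -/
theorem exists_monic_recurrence {U : ℕ → ℕ} (hU : IsPositionalSystem U)
    (hreg : (numerationLanguage U).IsRegular) :
    ∃ P : Polynomial ℤ, P.Monic ∧
      ∀ n, ∑ k ∈ Finset.range (P.natDegree + 1), P.coeff k * (U (n + k) : ℤ) = 0 := by
  classical
  obtain ⟨σ, _, M, hM⟩ := hreg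
  have hcount : ∀ n, (countOp M ^ n) (fun q => if q ∈ M.accept then 1 else 0) M.start = U n := by
    intro n
    rw [countOp_pow_apply, ← sum_ite_isGreedy hU]
    refine Finset.sum_congr rfl fun w _ => ?_
    congr 1
    rw [← mem_numerationLanguage_iff hU, ← hM]
    rfl
  -- `U n` is read off the `n`-th power of `countOp M`, so Cayley–Hamilton provides the recurrence.
  refine ⟨(countOp M).charpoly, LinearMap.charpoly_monic _, fun n => ?_⟩
  have h := LinearMap.aeval_self_charpoly (countOp M)
  rw [Polynomial.aeval_eq_sum_range] at h
  have h1 := congrFun (LinearMap.congr_fun h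
    ((countOp M ^ n) (fun q => if q ∈ M.accept then 1 else 0))) M.start
  rw [LinearMap.sum_apply, Finset.sum_apply] at h1
  rw [LinearMap.zero_apply, Pi.zero_apply] at h1
  rw [← h1]
  refine Finset.sum_congr rfl fun k _ => ?_
  rw [LinearMap.smul_apply, Pi.smul_apply, smul_eq_mul, ← Module.End.mul_apply, ← pow_add,
    Nat.add_comm k n, hcount]

/-! ### The greedy expansion of 1 and the asymptotics of its factors. -/

/-- The factor `t_k ⋯ t_{k+n-1}` of the greedy expansion of `1`. -/
noncomputable def digitBlock (β : ℝ) (k n : ℕ) : List ℕ :=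
  (List.range' k n).map (digit β)

theorem length_digitBlock (β : ℝ) (k n : ℕ) : (digitBlock β k n).length = n := by
  simp [digitBlock]

theorem digitBlock_succ (β : ℝ) (k n : ℕ) :
    digitBlock β k (n + 1) = digit β k :: digitBlock β (k + 1) n := by
  simp [digitBlock, List.range'_succ]

theorem digitBlock_concat (β : ℝ) (k n : ℕ) :
    digitBlock β k (n + 1) = digitBlock β k n ++ [digit β (k + n)] := by
  simp [digitBlock, List.range'_1_concat]

theorem drop_digitBlock (β : ℝ) (k n : ℕ) :
    (digitBlock β 0 n).drop k = digitBlock β k (n - k) := by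
  simp [digitBlock, ← List.map_drop, List.drop_range']

/-- The word `t_0 ⋯ t_{l-2} (t_{l-1} - 1)`. -/
noncomputable def quasiBlock (β : ℝ) (l : ℕ) : List ℕ :=
  digitBlock β 0 (l - 1) ++ [digit β (l - 1) - 1]

theorem remainder_nonneg {β : ℝ} (hβ : 1 ≤ β) (n : ℕ) : 0 ≤ remainder β n := by
  induction n with
  | zero => simp [remainder]
  | succ n ih => exact sub_nonneg.2 (Nat.floor_le (mul_nonneg (by linarith) ih))

theorem remainder_succ (β : ℝ) (n : ℕ) :
    remainder β (n + 1) = β * remainder β n - digit β n := rfl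

theorem remainder_succ_lt_one (β : ℝ) (n : ℕ) : remainder β (n + 1) < 1 := by
  have := Nat.lt_floor_add_one (β * remainder β n)
  rw [remainder]
  linarith

theorem one_le_digit_zero {β : ℝ} (hβ : 1 ≤ β) : 1 ≤ digit β 0 := by
  rw [digit, remainder, mul_one]
  exact Nat.le_floor (by simpa using hβ)

theorem IsFiniteOfLength.pos {β : ℝ} (hβ : 1 ≤ β) {l : ℕ} (hl : IsFiniteOfLength (digit β) l) :
    0 < l := by
  rcases Nat.eq_zero_or_pos l with rfl | h
  · have h1 := hl.1 0 le_rfl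
    have h2 := one_le_digit_zero hβ
    omega
  · exact h

theorem IsFiniteOfLength.last_ne_zero {β : ℝ} (hβ : 1 ≤ β) {l : ℕ}
    (hl : IsFiniteOfLength (digit β) l) : digit β (l - 1) ≠ 0 := by
  intro h
  have hpos := hl.pos hβ
  have h2 : l ≤ l - 1 := hl.2 fun n hn => by
    rcases Nat.eq_or_lt_of_le hn with rfl | h3
    · exact h
    · exact hl.1 n (by omega)
  omega

/-- For β > 1, zero digits multiply the remainder by β at each step while it must stay below 1, so
it vanishes. For β = 1 it vanishes after one step. -/
theorem IsFiniteOfLength.remainder_eq_zero {β : ℝ} (hβ : 1 ≤ β) {l : ℕ}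
    (hl : IsFiniteOfLength (digit β) l) : remainder β l = 0 := by
  have hpos := hl.pos hβ
  obtain ⟨k, rfl⟩ : ∃ k, l = k + 1 := ⟨l - 1, by omega⟩
  rcases hβ.eq_or_lt with rfl | hlt
  · have key : ∀ n, remainder 1 (n + 1) = 0 := by
      intro n
      induction n with
      | zero => simp [remainder]
      | succ n ih => rw [remainder, ih]; simp
    exact key k
  · have h1 : ∀ s, remainder β (k + 1 + s) = β ^ s * remainder β (k + 1) := by
      intro s
      induction s with
      | zero => simp
      | succ s ih =>
        rw [← Nat.add_assoc, remainder_succ, hl.1 _ (by omega), ih]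
        push_cast
        ring
    by_contra hne
    have h2 : 0 < remainder β (k + 1) := lt_of_le_of_ne (remainder_nonneg hβ _) (Ne.symm hne)
    obtain ⟨s, hs⟩ := pow_unbounded_of_one_lt (remainder β (k + 1))⁻¹ hlt
    have h3 := remainder_succ_lt_one β (k + s)
    rw [show k + s + 1 = k + 1 + s by omega, h1] at h3
    rw [inv_lt_iff_one_lt_mul₀ h2] at hs
    linarith

theorem tendsto_ratio {U : ℕ → ℕ} (hU : IsPositionalSystem U) {β : ℝ}
    (hroot : HasDominantRoot U β) (j : ℕ) :
    Tendsto (fun n => (U (n + j) : ℝ) / U n) atTop (𝓝 (β ^ j)) := by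
  induction j with
  | zero =>
    have : (fun n => (U (n + 0) : ℝ) / U n) = fun _ => 1 := by
      ext n
      have : (U n : ℝ) ≠ 0 := by exact_mod_cast (hU.pos n).ne'
      simp [this]
    rw [this]
    simp
  | succ j ih =>
    have h1 := (hroot.comp (tendsto_add_atTop_nat j)).mul ih
    rw [pow_succ']
    refine h1.congr fun n => ?_
    have h2 : (U n : ℝ) ≠ 0 := by exact_mod_cast (hU.pos n).ne'
    have h3 : (U (n + j) : ℝ) ≠ 0 := by exact_mod_cast (hU.pos (n + j)).ne'
    simp only [Function.comp]
    field_simp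
    rfl

theorem tendsto_shiftVal_digitBlock {U : ℕ → ℕ} (hU : IsPositionalSystem U) {β : ℝ}
    (hroot : HasDominantRoot U β) (k n : ℕ) :
    Tendsto (fun m => (shiftVal U m (digitBlock β k n) : ℝ) / U m) atTop
      (𝓝 (remainder β k * β ^ n - remainder β (k + n))) := by
  induction n generalizing k with
  | zero => simp [digitBlock, shiftVal]
  | succ n ih =>
    have h1 := ((tendsto_ratio hU hroot n).const_mul (digit β k : ℝ)).add (ih (k + 1))
    have h2 : remainder β k * β ^ (n + 1) - remainder β (k + (n + 1)) =
        (digit β k : ℝ) * β ^ n +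
          (remainder β (k + 1) * β ^ n - remainder β (k + 1 + n)) := by
      rw [remainder_succ, show k + 1 + n = k + (n + 1) by omega]
      ring
    rw [h2]
    refine h1.congr fun m => ?_
    rw [digitBlock_succ, shiftVal, length_digitBlock]
    push_cast
    ring

theorem shiftVal_digitBlock (U : ℕ → ℕ) (β : ℝ) (m k n : ℕ) :
    shiftVal U m (digitBlock β k n) =
      ∑ j ∈ Finset.range n, digit β (k + j) * U (m + n - (j + 1)) := by
  induction n generalizing k with
  | zero => simp [digitBlock, shiftVal]
  | succ n ih =>
    rw [digitBlock_succ, shiftVal, length_digitBlock, Finset.sum_range_succ', ih, add_comm]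
    congr 1
    refine Finset.sum_congr rfl fun j _ => ?_
    congr 2 <;> omega

theorem Delta_add_eq (U : ℕ → ℕ) (β : ℝ) (l m : ℕ) :
    Delta U β l (m + l) = U (m + l) - shiftVal U m (digitBlock β 0 l) := by
  rw [Delta, shiftVal_digitBlock, ← Finset.Ico_succ_right_eq_Icc, Finset.sum_Ico_eq_sum_range]
  push_cast
  congr 1
  refine Finset.sum_congr (by simp) fun j _ => ?_
  rw [show 1 + j - 1 = 0 + j by omega, Nat.add_comm 1 j]

theorem tendsto_Delta_div {U : ℕ → ℕ} (hU : IsPositionalSystem U) {β : ℝ} (hβ : 1 ≤ β)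
    (hroot : HasDominantRoot U β) {l : ℕ} (hl : IsFiniteOfLength (digit β) l) :
    Tendsto (fun m => (Delta U β l (m + l) : ℝ) / U m) atTop (𝓝 0) := by
  have h1 := (tendsto_ratio hU hroot l).sub (tendsto_shiftVal_digitBlock hU hroot 0 l)
  rw [zero_add, hl.remainder_eq_zero hβ] at h1
  simp only [remainder, one_mul, sub_zero, sub_self] at h1
  refine h1.congr fun m => ?_
  rw [Delta_add_eq]
  push_cast
  ring

theorem eventually_abs_Delta_le {U : ℕ → ℕ} (hU : IsPositionalSystem U) {β : ℝ} (hβ : 1 ≤ β)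
    (hroot : HasDominantRoot U β) {l : ℕ} (hl : IsFiniteOfLength (digit β) l) (k : ℕ) {ε : ℝ}
    (hε : 0 < ε) : ∀ᶠ m in atTop, |(Delta U β l (m + k + l) : ℝ)| ≤ ε * U m := by
  have h1 := ((tendsto_Delta_div hU hβ hroot hl).comp (tendsto_add_atTop_nat k)).mul
    (tendsto_ratio hU hroot k)
  rw [zero_mul] at h1
  filter_upwards [h1.abs.eventually_lt_const (by simpa using hε)] with m hm
  have h2 : (0 : ℝ) < U m := by exact_mod_cast hU.pos m
  have h3 : (U (m + k) : ℝ) ≠ 0 := by exact_mod_cast (hU.pos (m + k)).ne'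
  simp only [Function.comp] at hm
  rw [div_mul_div_cancel₀ h3, abs_div, abs_of_pos h2, div_lt_iff₀ h2] at hm
  exact hm.le

/-- After division by `U m`, the suffix starting at `k` tends to at most r_k β^(l-k), where r_k < 1
for k ≥ 1. The strict gap leaves room for a uniform ε. -/
theorem exists_tail_bound {U : ℕ → ℕ} (hU : IsPositionalSystem U) {β : ℝ} (hβ : 1 ≤ β)
    (hroot : HasDominantRoot U β) (l : ℕ) :
    ∃ ε > (0 : ℝ), ∀ᶠ m in atTop, ∀ k ∈ Finset.range l, 1 ≤ k →
      (shiftVal U m (digitBlock β k (l - k)) : ℝ) + ε * U m < U (m + (l - k)) := by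
  have h1 : ∀ᶠ ε in 𝓝[>] (0 : ℝ), ∀ k ∈ Finset.range l, 1 ≤ k → ε < 1 - remainder β k := by
    rw [Filter.eventually_all_finset]
    intro k _
    rcases Nat.eq_zero_or_pos k with rfl | hk
    · simp
    · obtain ⟨k, rfl⟩ : ∃ j, k = j + 1 := ⟨k - 1, by omega⟩
      have := remainder_succ_lt_one β k
      filter_upwards [nhdsWithin_le_nhds (gt_mem_nhds (sub_pos.2 this))] with ε h _ using h
  obtain ⟨ε, hε, hpos⟩ := (h1.and self_mem_nhdsWithin).exists
  refine ⟨ε, hpos, ?_⟩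
  rw [Filter.eventually_all_finset]
  intro k hk
  rcases Nat.eq_zero_or_pos k with rfl | hk1
  · simp
  have h2 := hε k hk hk1
  -- The gap (1 - r_k) β^(l-k) is at least 1 - r_k > ε because β ≥ 1.
  have h3 : remainder β k * β ^ (l - k) - remainder β (k + (l - k)) + ε < β ^ (l - k) := by
    have h4 := remainder_nonneg hβ (k + (l - k))
    have h5 : 1 ≤ β ^ (l - k) := one_le_pow₀ hβ
    have h6 : 0 < 1 - remainder β k := lt_trans hpos h2
    nlinarith
  filter_upwards [((tendsto_shiftVal_digitBlock hU hroot k (l - k)).add_const ε).eventually_lt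
    (tendsto_ratio hU hroot (l - k)) h3] with m hm _
  have h7 : (0 : ℝ) < U m := by exact_mod_cast hU.pos m
  rw [lt_div_iff₀ h7, add_mul, div_mul_cancel₀ _ h7.ne'] at hm
  exact hm

/-! ### Blocks placed in front of a greedy word. -/

theorem length_quasiBlock {β : ℝ} {l : ℕ} (hl : 0 < l) : (quasiBlock β l).length = l := by
  simp [quasiBlock, length_digitBlock]
  omega

theorem shiftVal_drop_quasiBlock {U : ℕ → ℕ} {β : ℝ} (hβ : 1 ≤ β) {l : ℕ}
    (hl : IsFiniteOfLength (digit β) l) (m : ℕ) {k : ℕ} (hk : k < l) :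
    shiftVal U m ((quasiBlock β l).drop k) + U m =
      shiftVal U m (digitBlock β k (l - k)) := by
  have h1 : digitBlock β k (l - k) = digitBlock β k (l - 1 - k) ++ [digit β (l - 1)] := by
    rw [show l - k = l - 1 - k + 1 by omega, digitBlock_concat]
    congr 3
    omega
  rw [quasiBlock, List.drop_append_of_le_length (by rw [length_digitBlock]; omega),
    drop_digitBlock, h1, shiftVal_append, shiftVal_append]
  have h2 := hl.last_ne_zero hβ
  obtain ⟨d, hd⟩ : ∃ d, digit β (l - 1) = d + 1 := ⟨digit β (l - 1) - 1, by omega⟩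
  simp only [shiftVal, hd, List.length_singleton, List.length_nil, add_zero,
    Nat.add_sub_cancel]
  ring

theorem shiftVal_quasiBlock {U : ℕ → ℕ} {β : ℝ} (hβ : 1 ≤ β) {l : ℕ}
    (hl : IsFiniteOfLength (digit β) l) (m : ℕ) :
    (shiftVal U m (quasiBlock β l) : ℤ) = U (m + l) - Delta U β l (m + l) - U m := by
  have h1 := shiftVal_drop_quasiBlock (U := U) hβ hl m (hl.pos hβ)
  rw [List.drop_zero, Nat.sub_zero] at h1
  rw [Delta_add_eq, ← h1]
  push_cast
  ring

/-- The margin of `exists_tail_bound` settles all proper suffixes. For `quasiBlock` the lowered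
digit frees a full `U v.length`, which exceeds `val U v`; for `digitBlock` only ε `U v.length` is
free, hence the smallness assumption. -/
theorem exists_isGreedy_block_iff {U : ℕ → ℕ} (hU : IsPositionalSystem U) {β : ℝ} (hβ : 1 ≤ β)
    (hroot : HasDominantRoot U β) {l : ℕ} (hl : IsFiniteOfLength (digit β) l) :
    ∃ ε > (0 : ℝ), ∃ m₀, ∀ v, IsGreedy U v → m₀ ≤ v.length →
      (IsGreedy U (quasiBlock β l ++ v) ↔
        (val U v : ℤ) < U v.length + Delta U β l (v.length + l)) ∧
      ((val U v : ℝ) ≤ ε * U v.length →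
        (IsGreedy U (digitBlock β 0 l ++ v) ↔ (val U v : ℤ) < Delta U β l (v.length + l))) := by
  obtain ⟨ε, hε, h⟩ := exists_tail_bound hU hβ hroot l
  obtain ⟨m₀, hm₀⟩ := eventually_atTop.1 h
  refine ⟨ε, hε, m₀, fun v hv hlen => ?_⟩
  have hb := hm₀ _ hlen
  have hpos := hl.pos hβ
  constructor
  · have hq : quasiBlock β l ≠ [] := by simp [quasiBlock]
    rw [isGreedy_append_iff hv hq]
    · have h1 := shiftVal_quasiBlock (U := U) hβ hl v.length
      rw [length_quasiBlock hpos]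
      zify
      constructor <;> intro <;> linarith
    · intro k hk hk'
      rw [length_quasiBlock hpos] at hk' ⊢
      have h1 := shiftVal_drop_quasiBlock (U := U) hβ hl v.length hk'
      have h2 := hb k (Finset.mem_range.2 hk') hk
      have h3 : shiftVal U v.length (digitBlock β k (l - k)) < U (v.length + (l - k)) := by
        have : (0 : ℝ) ≤ ε * U v.length := by positivity
        have : (shiftVal U v.length (digitBlock β k (l - k)) : ℝ) < U (v.length + (l - k)) := by
          linarith
        exact_mod_cast this
      have h4 := hv.val_lt hU
      omega
  · intro hsmall
    have hq : digitBlock β 0 l ≠ [] := by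
      intro h
      have := length_digitBlock β 0 l
      rw [h] at this
      simp at this
      omega
    rw [isGreedy_append_iff hv hq]
    · rw [length_digitBlock, Delta_add_eq]
      zify
      constructor <;> intro <;> linarith
    · intro k hk hk'
      rw [length_digitBlock] at hk' ⊢
      have h2 := hb k (Finset.mem_range.2 hk') hk
      rw [drop_digitBlock]
      have : (shiftVal U v.length (digitBlock β k (l - k)) : ℝ) + val U v <
          U (v.length + (l - k)) := by
        linarith
      exact_mod_cast this

/-- The concatenation of `j` copies of a word. -/
def wordPow (q : List ℕ) : ℕ → List ℕ
  | 0 => []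
  | j + 1 => q ++ wordPow q j

theorem length_wordPow (q : List ℕ) (j : ℕ) : (wordPow q j).length = j * q.length := by
  induction j with
  | zero => simp [wordPow]
  | succ j ih => rw [wordPow, List.length_append, ih]; ring

/-- The sum `∑_{r=1}^{s} Δ_{m+rl}`. -/
noncomputable def deltaSum (U : ℕ → ℕ) (β : ℝ) (l s m : ℕ) : ℤ :=
  ∑ r ∈ Finset.range s, Delta U β l (m + r * l + l)

theorem deltaSum_zero (U : ℕ → ℕ) (β : ℝ) (l m : ℕ) : deltaSum U β l 0 m = 0 := rfl

theorem deltaSum_succ (U : ℕ → ℕ) (β : ℝ) (l s m : ℕ) :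
    deltaSum U β l (s + 1) m = deltaSum U β l s m + Delta U β l (m + s * l + l) :=
  Finset.sum_range_succ _ _

theorem deltaSum_add (U : ℕ → ℕ) (β : ℝ) (l s s' m : ℕ) :
    deltaSum U β l (s + s') m = deltaSum U β l s m + deltaSum U β l s' (m + s * l) := by
  rw [deltaSum, Finset.sum_range_add, deltaSum, deltaSum]
  congr 1
  refine Finset.sum_congr rfl fun r _ => ?_
  congr 1
  ring

theorem val_wordPow_append {U : ℕ → ℕ} {β : ℝ} (hβ : 1 ≤ β) {l : ℕ}
    (hl : IsFiniteOfLength (digit β) l) (j : ℕ) (v : List ℕ) :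
    (val U (wordPow (quasiBlock β l) j ++ v) : ℤ) =
      U (v.length + j * l) - U v.length - deltaSum U β l j v.length + val U v := by
  induction j with
  | zero => simp [wordPow, deltaSum_zero]
  | succ j ih =>
    rw [wordPow, List.append_assoc, val_append, Nat.cast_add, shiftVal_quasiBlock hβ hl, ih,
      List.length_append, length_wordPow, length_quasiBlock (hl.pos hβ), deltaSum_succ,
      Nat.add_comm (j * l), show v.length + (j + 1) * l = v.length + j * l + l by ring]
    ring

theorem isGreedy_wordPow_append_iff {U : ℕ → ℕ} (hU : IsPositionalSystem U) {β : ℝ}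
    (hβ : 1 ≤ β) {l : ℕ} (hl : IsFiniteOfLength (digit β) l) {m₀ : ℕ}
    (hblock : ∀ v, IsGreedy U v → m₀ ≤ v.length → (IsGreedy U (quasiBlock β l ++ v) ↔
      (val U v : ℤ) < U v.length + Delta U β l (v.length + l)))
    (j : ℕ) {v : List ℕ} (hv : IsGreedy U v) (hm : m₀ ≤ v.length) :
    IsGreedy U (wordPow (quasiBlock β l) j ++ v) ↔
      ∀ s ≤ j, (val U v : ℤ) < U v.length + deltaSum U β l s v.length := by
  induction j with
  | zero =>
    have := hv.val_lt hU
    simp [wordPow, deltaSum_zero, hv, this]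
  | succ j ih =>
    have hlen : (wordPow (quasiBlock β l) j ++ v).length = v.length + j * l := by
      rw [List.length_append, length_wordPow, length_quasiBlock (hl.pos hβ), Nat.add_comm]
    have key : IsGreedy U (wordPow (quasiBlock β l) j ++ v) →
        (IsGreedy U (quasiBlock β l ++ (wordPow (quasiBlock β l) j ++ v)) ↔
          (val U v : ℤ) < U v.length + deltaSum U β l (j + 1) v.length) := by
      intro h
      rw [hblock _ h (by omega), hlen, val_wordPow_append hβ hl, deltaSum_succ]
      constructor <;> intro <;> linarith
    rw [wordPow, List.append_assoc]
    constructor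
    · intro h s hs
      have h1 := h.of_append
      rcases Nat.eq_or_lt_of_le hs with rfl | hs
      · exact (key h1).1 h
      · exact ih.1 h1 s (by omega)
    · intro h
      exact (key (ih.2 fun s hs => h s (by omega))).2 (h _ le_rfl)

theorem IsPositionalSystem.tendsto_atTop {U : ℕ → ℕ} (hU : IsPositionalSystem U) :
    Tendsto U atTop atTop :=
  hU.strictMono.tendsto_atTop

/-- Each Δ_{m+k+l} with `k` fixed is o(U_m), hence so is a sum of `j` of them. The bound makes the
witness in `exists_deltaSum_le` nonnegative. -/
theorem eventually_deltaSum_ge {U : ℕ → ℕ} (hU : IsPositionalSystem U) {β : ℝ} (hβ : 1 ≤ β)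
    (hroot : HasDominantRoot U β) {l : ℕ} (hl : IsFiniteOfLength (digit β) l) (j : ℕ) :
    ∀ᶠ m in atTop, 1 - (U m : ℤ) ≤ deltaSum U β l j m := by
  have h1 : ∀ ε > (0 : ℝ), ∀ᶠ m in atTop, -(ε * U m) ≤ (deltaSum U β l j m : ℝ) := by
    induction j with
    | zero =>
      intro ε hε
      refine Eventually.of_forall fun m => ?_
      rw [deltaSum_zero]
      have : (0 : ℝ) ≤ ε * U m := by positivity
      simpa using this
    | succ j ih =>
      intro ε hε
      filter_upwards [ih (ε / 2) (by linarith),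
        eventually_abs_Delta_le hU hβ hroot hl (j * l) (half_pos hε)] with m h1 h2
      rw [deltaSum_succ]
      push_cast
      linarith [(abs_le.1 h2).1]
  filter_upwards [h1 (1 / 2) (by norm_num), hU.tendsto_atTop.eventually_ge_atTop 2] with m h2 h3
  have h4 : (2 : ℝ) ≤ U m := by exact_mod_cast h3
  have : (1 : ℝ) - U m ≤ deltaSum U β l j m := by linarith
  exact_mod_cast this

/-! ### Regularity makes Δ bounded, then ultimately periodic. -/

/-- In the regular case the partial sums of `Δ` along steps of length `l` have no late new
minima. -/
theorem exists_deltaSum_le {U : ℕ → ℕ} (hU : IsPositionalSystem U) {β : ℝ} (hβ : 1 ≤ β)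
    (hroot : HasDominantRoot U β) {l : ℕ} (hl : IsFiniteOfLength (digit β) l)
    (hreg : (numerationLanguage U).IsRegular) :
    ∃ j m₀, ∀ m ≥ m₀, ∃ s ≤ j, deltaSum U β l s m ≤ deltaSum U β l (j + 1) m := by
  obtain ⟨ε, hε, m₁, hblock⟩ := exists_isGreedy_block_iff hU hβ hroot hl
  obtain ⟨j, j', hjj, heq⟩ := exists_lt_isGreedy_append_iff hU hreg (wordPow (quasiBlock β l))
  have hev : ∀ᶠ m in atTop, ∀ s ∈ Finset.range (j + 1), 1 - (U m : ℤ) ≤ deltaSum U β l s m := by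
    rw [Filter.eventually_all_finset]
    exact fun s _ => eventually_deltaSum_ge hU hβ hroot hl s
  obtain ⟨m₂, hm₂⟩ := eventually_atTop.1 hev
  refine ⟨j, max m₁ m₂, fun m hm => ?_⟩
  obtain ⟨s, hs, hmin⟩ := Finset.exists_min_image (Finset.range (j + 1))
    (fun s => deltaSum U β l s m) ⟨0, by simp⟩
  refine ⟨s, by simpa [Nat.lt_succ_iff] using hs, ?_⟩
  have h1 := hm₂ m (le_trans (le_max_right _ _) hm) s hs
  have h2 := hmin 0 (by simp)
  simp only [deltaSum_zero] at h2
  -- The largest value that q^j still tolerates. As q^j and q^{j'} have the same continuations,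
  -- q^{j+1} tolerates it too.
  obtain ⟨x, hx⟩ := Int.eq_ofNat_of_zero_le (show 0 ≤ (U m : ℤ) - 1 + deltaSum U β l s m by
    linarith)
  have hxU : x < U m := by
    zify
    linarith
  obtain ⟨hg, hval⟩ := greedyDigits_spec hU hxU
  have hlen := length_greedyDigits U m x
  have h3 := isGreedy_wordPow_append_iff hU hβ hl (fun v hv hm => (hblock v hv hm).1) j hg
    (by rw [hlen]; exact le_trans (le_max_left _ _) hm)
  have h4 := isGreedy_wordPow_append_iff hU hβ hl (fun v hv hm => (hblock v hv hm).1) j' hg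
    (by rw [hlen]; exact le_trans (le_max_left _ _) hm)
  rw [hlen, hval] at h3 h4
  have h5 := h3.2 fun s' hs' => by
    have := hmin s' (Finset.mem_range.2 (by omega))
    linarith
  have h6 := h4.1 ((heq _).1 h5) (j + 1) hjj
  linarith

/-- Zeros keep the value of a tail, so d 0^k v is greedy iff val v < Δ_{|v|+k+l}, for small values.
Two exponents k < k' with the same continuations then bound each late positive Δ_n by max(0,
Δ_{n-(k'-k)}). -/
theorem exists_Delta_le {U : ℕ → ℕ} (hU : IsPositionalSystem U) {β : ℝ} (hβ : 1 ≤ β)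
    (hroot : HasDominantRoot U β) {l : ℕ} (hl : IsFiniteOfLength (digit β) l)
    (hreg : (numerationLanguage U).IsRegular) :
    ∃ B : ℤ, 0 ≤ B ∧ ∀ n, Delta U β l n ≤ B := by
  obtain ⟨ε, hε, m₁, hblock⟩ := exists_isGreedy_block_iff hU hβ hroot hl
  obtain ⟨k, k', hkk, heq⟩ := exists_lt_isGreedy_append_iff hU hreg
    fun k => digitBlock β 0 l ++ List.replicate k 0
  have hmin : 0 < min ε 1 := lt_min hε one_pos
  obtain ⟨m₂, hm₂⟩ := eventually_atTop.1
    (eventually_abs_Delta_le hU hβ hroot hl k' hmin)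
  have hgreedy : ∀ m ≥ m₁, ∀ x : ℕ, x < U m → (x : ℝ) ≤ ε * U m → ∀ i,
      (IsGreedy U (digitBlock β 0 l ++ List.replicate i 0 ++ greedyDigits U m x) ↔
        (x : ℤ) < Delta U β l (m + i + l)) := by
    intro m hm x hx hxε i
    obtain ⟨hg, hval⟩ := greedyDigits_spec hU hx
    have hlen : (List.replicate i 0 ++ greedyDigits U m x).length = m + i := by
      rw [List.length_append, length_greedyDigits, List.length_replicate, Nat.add_comm]
    have h := (hblock _ (hg.replicate_zero_append hU i) (by omega)).2
    rw [hlen, val_replicate_zero_append, hval] at h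
    rw [List.append_assoc]
    refine h (hxε.trans ?_)
    gcongr
    exact hU.strictMono.monotone (Nat.le_add_right m i)
  have hstep : ∀ m ≥ max m₁ m₂,
      Delta U β l (m + k' + l) ≤ max 0 (Delta U β l (m + k + l)) := by
    intro m hm
    by_contra! h
    have h0 := lt_of_le_of_lt (le_max_left _ _) h
    have h1 := lt_of_le_of_lt (le_max_right _ _) h
    -- The value Δ_{m+k'+l} - 1 is allowed after d 0^{k'} but would not be allowed after d 0^k.
    obtain ⟨x, hx⟩ := Int.eq_ofNat_of_zero_le (show 0 ≤ Delta U β l (m + k' + l) - 1 by omega)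
    have h2 := (abs_le.1 (hm₂ m (le_trans (le_max_right _ _) hm))).2
    have h3 : (Delta U β l (m + k' + l) : ℝ) = x + 1 := by
      have : Delta U β l (m + k' + l) = x + 1 := by linarith
      exact_mod_cast this
    have h4 : (0 : ℝ) ≤ U m := by positivity
    have h5 : min ε 1 * U m ≤ ε * U m := mul_le_mul_of_nonneg_right (min_le_left _ _) h4
    have h6 : min ε 1 * U m ≤ 1 * U m := mul_le_mul_of_nonneg_right (min_le_right _ _) h4
    have hxU : x < U m := by
      have : (x : ℝ) < U m := by linarith
      exact_mod_cast this
    have h7 := hgreedy m (le_trans (le_max_left _ _) hm) x hxU (by linarith)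
    have h8 := (h7 k).1 ((heq _).2 ((h7 k').2 (by linarith)))
    linarith
  set N := max m₁ m₂ + k + l
  refine ⟨∑ n ∈ Finset.range (N + (k' - k)), |Delta U β l n|,
    Finset.sum_nonneg fun _ _ => abs_nonneg _, fun n => ?_⟩
  induction n using Nat.strong_induction_on with
  | _ n ih =>
    by_cases hn : n < N + (k' - k)
    · exact (le_abs_self _).trans (Finset.single_le_sum
        (f := fun n => |Delta U β l n|) (fun _ _ => abs_nonneg _) (Finset.mem_range.2 hn))
    · have h1 := hstep (n - k' - l) (by omega)
      rw [show n - k' - l + k' + l = n by omega] at h1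
      exact h1.trans (max_le (Finset.sum_nonneg fun _ _ => abs_nonneg _) (ih _ (by omega)))

/-- By `exists_deltaSum_le`, the last term of S_{j+1}(m) is at least minus a sum of at most `j`
earlier terms, each at most `B`. -/
theorem exists_abs_Delta_le {U : ℕ → ℕ} (hU : IsPositionalSystem U) {β : ℝ} (hβ : 1 ≤ β)
    (hroot : HasDominantRoot U β) {l : ℕ} (hl : IsFiniteOfLength (digit β) l)
    (hreg : (numerationLanguage U).IsRegular) :
    ∃ (B : ℤ) (n₀ : ℕ), ∀ n ≥ n₀, |Delta U β l n| ≤ B := by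
  obtain ⟨B, hB0, hB⟩ := exists_Delta_le hU hβ hroot hl hreg
  obtain ⟨j, m₀, hj⟩ := exists_deltaSum_le hU hβ hroot hl hreg
  refine ⟨(j + 1) * B, m₀ + (j * l + l), fun n hn => ?_⟩
  have hjB : 0 ≤ j * B := by positivity
  rw [abs_le]
  refine ⟨?_, by linarith [hB n]⟩
  obtain ⟨m, rfl⟩ := Nat.exists_eq_add_of_le' hn
  obtain ⟨s, hs, h⟩ := hj (m + m₀) (by omega)
  obtain ⟨i, rfl⟩ := Nat.exists_eq_add_of_le hs
  rw [deltaSum_succ, deltaSum_add, add_assoc (m + m₀)] at h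
  have h1 : deltaSum U β l i (m + m₀ + s * l) ≤ i * B := by
    rw [deltaSum]
    refine (Finset.sum_le_card_nsmul _ _ B fun r _ => hB _).trans ?_
    simp
  have h2 : 0 ≤ s * B := by positivity
  rw [show m + (m₀ + ((s + i) * l + l)) = m + m₀ + ((s + i) * l + l) by ring]
  push_cast
  linarith

/-- Bounded integers leave finitely many windows of length `P.natDegree`. A repeated window
propagates forward since `P` is monic. -/
theorem exists_period_of_bounded {a : ℕ → ℤ} {P : Polynomial ℤ} (hP : P.Monic)
    (hrec : ∀ n, ∑ k ∈ Finset.range (P.natDegree + 1), P.coeff k * a (n + k) = 0)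
    {B : ℤ} {n₀ : ℕ} (hB : ∀ n ≥ n₀, |a n| ≤ B) :
    ∃ N M, 0 < M ∧ ∀ n ≥ N, a (n + M) = a n := by
  let F : ℕ → Fin P.natDegree → Set.Icc (-B) B := fun i k =>
    ⟨a (n₀ + i + k), abs_le.1 (hB _ (by omega))⟩
  obtain ⟨i, j, hne, hij⟩ := Finite.exists_ne_map_eq_of_infinite F
  wlog hlt : i < j generalizing i j
  · exact this j i hne.symm hij.symm (by omega)
  refine ⟨n₀ + i, j - i, by omega, fun n => ?_⟩
  have hstep : ∀ n, a (n + P.natDegree) = -∑ k ∈ Finset.range P.natDegree, P.coeff k * a (n + k) := by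
    intro n
    have := hrec n
    rw [Finset.sum_range_succ, hP.coeff_natDegree, one_mul] at this
    linarith
  induction n using Nat.strong_induction_on with
  | _ n ih =>
    intro hn
    by_cases hsmall : n < n₀ + i + P.natDegree
    · have h1 := congrArg Subtype.val (congrFun hij ⟨n - (n₀ + i), by omega⟩)
      simp only [F] at h1
      rw [show n₀ + i + (n - (n₀ + i)) = n by omega,
        show n₀ + j + (n - (n₀ + i)) = n + (j - i) by omega] at h1
      exact h1.symm
    · obtain ⟨m, rfl⟩ : ∃ m, n = m + P.natDegree := ⟨n - P.natDegree, by omega⟩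
      rw [show m + P.natDegree + (j - i) = m + (j - i) + P.natDegree by omega, hstep, hstep]
      congr 1
      refine Finset.sum_congr rfl fun k hk => ?_
      have hk' := Finset.mem_range.1 hk
      rw [show m + (j - i) + k = m + k + (j - i) by omega, ih _ (by omega) (by omega)]

/-- If the numeration language is regular, then `Δ` is ultimately periodic. -/
theorem exists_period_Delta {U : ℕ → ℕ} (hU : IsPositionalSystem U) {β : ℝ} (hβ : 1 ≤ β)
    (hroot : HasDominantRoot U β) {l : ℕ} (hl : IsFiniteOfLength (digit β) l)
    (hreg : (numerationLanguage U).IsRegular) :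
    ∃ N M, l ≤ N ∧ HasPreperiodPeriod (Delta U β l) N M := by
  obtain ⟨B, n₀, hB⟩ := exists_abs_Delta_le hU hβ hroot hl hreg
  obtain ⟨P, hP, hrec⟩ := exists_monic_recurrence hU hreg
  obtain ⟨N, M, hM, h⟩ := exists_period_of_bounded (a := fun n => Delta U β l (n + l)) hP
    (fun n => by
      simp only [Delta_add_eq, shiftVal_digitBlock, mul_sub, Finset.sum_sub_distrib]
      push_cast
      simp only [Finset.mul_sum]
      rw [Finset.sum_comm]
      have h1 : ∑ k ∈ Finset.range (P.natDegree + 1), P.coeff k * (U (n + k + l) : ℤ) = 0 := by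
        rw [← hrec (n + l)]
        exact Finset.sum_congr rfl fun k _ => by rw [Nat.add_right_comm]
      rw [h1, zero_sub, neg_eq_zero]
      refine Finset.sum_eq_zero fun j hj => ?_
      have h2 := hrec (n + l - (j + 1))
      rw [← mul_zero (digit β (0 + j) : ℤ), ← h2, Finset.mul_sum]
      refine Finset.sum_congr rfl fun k _ => ?_
      have hj' := Finset.mem_range.1 hj
      rw [show n + k + l - (j + 1) = n + l - (j + 1) + k by omega]
      ring)
    (B := B) (n₀ := n₀) (fun n hn => hB _ (by omega))
  refine ⟨N + l, M, by omega, hM, fun n hn => ?_⟩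
  have := h (n - l) (by omega)
  rwa [show n - l + M + l = n + M by omega, show n - l + l = n by omega] at this

/-! ### Cycle sums and the necessity of the condition. -/

theorem sum_Delta_eq_deltaSum (U : ℕ → ℕ) (β : ℝ) {l M' n : ℕ} (hn : M' * l ≤ n) :
    ∑ j ∈ Finset.range M', Delta U β l (n - j * l) = deltaSum U β l M' (n - M' * l) := by
  rw [deltaSum, ← Finset.sum_range_reflect]
  refine Finset.sum_congr rfl fun j hj => ?_
  have hj' := Finset.mem_range.1 hj
  obtain ⟨i, rfl⟩ : ∃ i, M' = j + i + 1 := ⟨M' - j - 1, by omega⟩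
  have h1 : (j + i + 1) * l = j * l + i * l + l := by ring
  rw [show j + i + 1 - 1 - j = i by omega]
  congr 1
  omega

theorem deltaSum_add_period {U : ℕ → ℕ} {β : ℝ} {l N M : ℕ}
    (h : HasPreperiodPeriod (Delta U β l) N M) (s : ℕ) {m : ℕ} (hm : N ≤ m + l) :
    deltaSum U β l s (m + M) = deltaSum U β l s m := by
  refine Finset.sum_congr rfl fun r _ => ?_
  rw [show m + M + r * l + l = m + r * l + l + M by ring]
  exact h.2 _ (by omega)

/-- Shifting the start by `l` trades Δ_{m+l} for Δ_{m+l+M}, which is equal. -/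
theorem deltaSum_cycle_add {U : ℕ → ℕ} {β : ℝ} {l N M' : ℕ}
    (h : HasPreperiodPeriod (Delta U β l) N (M' * l)) {m : ℕ} (hm : N ≤ m + l) (k : ℕ) :
    deltaSum U β l M' (m + k * l) = deltaSum U β l M' m := by
  induction k with
  | zero => simp
  | succ k ih =>
    rw [← ih]
    have h1 := deltaSum_succ U β l M' (m + k * l)
    rw [Nat.add_comm M' 1, deltaSum_add, deltaSum_succ, deltaSum_zero] at h1
    have h2 := h.2 (m + k * l + l) (by omega)
    rw [show m + k * l + M' * l + l = m + k * l + l + M' * l by ring] at h1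
    rw [show m + (k + 1) * l = m + k * l + 1 * l by ring]
    simp only [Nat.zero_mul, add_zero, zero_add] at h1
    linarith

/-- The nonnegativity condition on one window of length `l` says that all cycle sums of `Δ` are
nonnegative. -/
theorem sum_Delta_nonneg_iff {U : ℕ → ℕ} {β : ℝ} {l N M' : ℕ} (hl : 0 < l) (hN : l ≤ N)
    (hM' : 1 ≤ M') (h : HasPreperiodPeriod (Delta U β l) N (M' * l)) :
    (∀ n ∈ Finset.Icc (N + M' * l - l) (N + M' * l - 1),
      0 ≤ ∑ j ∈ Finset.range M', Delta U β l (n - j * l)) ↔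
    ∀ m, N ≤ m + l → 0 ≤ deltaSum U β l M' m := by
  have hMl : l ≤ M' * l := Nat.le_mul_of_pos_left l hM'
  constructor
  · intro hc m hm
    have h1 := Nat.mod_add_div' (m + l - N) l
    have h2 := Nat.mod_lt (m + l - N) hl
    -- The window is a complete residue system modulo `l`, and cycle sums depend only on that
    -- residue.
    have h3 := hc (N + M' * l - l + (m + l - N) % l) (Finset.mem_Icc.2 ⟨by omega, by omega⟩)
    rw [sum_Delta_eq_deltaSum U β (by omega),
      ← deltaSum_cycle_add h (by omega) ((m + l - N) / l)] at h3
    convert h3 using 2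
    omega
  · intro hc n hn
    have := Finset.mem_Icc.1 hn
    rw [sum_Delta_eq_deltaSum U β (by omega)]
    exact hc _ (by omega)

theorem deltaSum_nonneg_of_isRegular {U : ℕ → ℕ} (hU : IsPositionalSystem U) {β : ℝ}
    (hβ : 1 ≤ β) (hroot : HasDominantRoot U β) {l : ℕ} (hl : IsFiniteOfLength (digit β) l)
    {N M' : ℕ} (h : HasPreperiodPeriod (Delta U β l) N (M' * l))
    (hreg : (numerationLanguage U).IsRegular) {m : ℕ} (hm : N ≤ m + l) :
    0 ≤ deltaSum U β l M' m := by
  obtain ⟨j, m₀, hj⟩ := exists_deltaSum_le hU hβ hroot hl hreg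
  by_contra! hneg
  have hpos := hl.pos hβ
  -- A shift by a multiple of `l` passes the threshold `m₀` without changing the cycle sum.
  set b := m + m₀ * l with hb
  have hbm : m₀ ≤ b := by
    have := Nat.le_mul_of_pos_right m₀ hpos
    omega
  have hmin : ∀ s, ∃ s' ≤ j, deltaSum U β l s' b ≤ deltaSum U β l s b := by
    intro s
    induction s using Nat.strong_induction_on with
    | _ s ih =>
      by_cases hs : s ≤ j
      · exact ⟨s, hs, le_rfl⟩
      · obtain ⟨i, rfl⟩ : ∃ i, s = i + (j + 1) := ⟨s - (j + 1), by omega⟩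
        obtain ⟨s', hs', h1⟩ := hj (b + i * l) (by omega)
        obtain ⟨s'', hs'', h2⟩ := ih (i + s') (by omega)
        refine ⟨s'', hs'', h2.trans ?_⟩
        rw [deltaSum_add, deltaSum_add]
        linarith
  have hcycle : ∀ a : ℕ, deltaSum U β l (a * M') b = a * deltaSum U β l M' m := by
    intro a
    induction a with
    | zero => simp [deltaSum_zero]
    | succ a ih =>
      rw [Nat.succ_mul, deltaSum_add, ih, hb,
        show m + m₀ * l + a * M' * l = m + (m₀ + a * M') * l by ring, deltaSum_cycle_add h hm]
      push_cast
      ring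
  set C := ∑ s ∈ Finset.range (j + 1), |deltaSum U β l s b| with hC
  -- After C + 1 cycles the sum is at most -(C + 1), below every S_s(b) with s ≤ j.
  obtain ⟨s, hs, hle⟩ := hmin ((C.toNat + 1) * M')
  have h1 : |deltaSum U β l s b| ≤ C := Finset.single_le_sum
    (f := fun s => |deltaSum U β l s b|) (fun _ _ => abs_nonneg _)
    (Finset.mem_range.2 (by omega))
  have h2 := neg_abs_le (deltaSum U β l s b)
  have h3 : C ≤ C.toNat := Int.self_le_toNat C
  rw [hcycle] at hle
  push_cast at hle
  nlinarith

/-! ### Shape of the maximal words and sufficiency of the condition. -/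

/-- The word q^j d w, with w of value `c`, has value U_n - S_{j+1}(m) + c = U_n - 1 for n = m +
(j+1)l, and the block criteria turn its greediness into `hT`. -/
theorem topWord_eq_of_deltaSum_eq_succ {U : ℕ → ℕ} (hU : IsPositionalSystem U) {β : ℝ}
    (hβ : 1 ≤ β) {l : ℕ} (hl : IsFiniteOfLength (digit β) l) {ε : ℝ} {m₀ : ℕ}
    (hblock : ∀ v, IsGreedy U v → m₀ ≤ v.length →
      (IsGreedy U (quasiBlock β l ++ v) ↔
        (val U v : ℤ) < U v.length + Delta U β l (v.length + l)) ∧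
      ((val U v : ℝ) ≤ ε * U v.length →
        (IsGreedy U (digitBlock β 0 l ++ v) ↔ (val U v : ℤ) < Delta U β l (v.length + l))))
    {m j c : ℕ} (hm : m₀ ≤ m) (hc : c < U m) (hcε : (c : ℝ) ≤ ε * U m)
    (hT : ∀ s ≤ j, (c : ℤ) < deltaSum U β l (s + 1) m)
    (hTj : deltaSum U β l (j + 1) m = c + 1) :
    topWord U (m + (j + 1) * l) =
      wordPow (quasiBlock β l) j ++ (digitBlock β 0 l ++ greedyDigits U m c) := by
  obtain ⟨hg, hval⟩ := greedyDigits_spec hU hc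
  have hlen := length_greedyDigits U m c
  have hsplit : ∀ s, deltaSum U β l (s + 1) m =
      Delta U β l (m + l) + deltaSum U β l s (m + l) := by
    intro s
    rw [Nat.add_comm s, deltaSum_add, deltaSum_succ, deltaSum_zero]
    simp
  have h1 : IsGreedy U (digitBlock β 0 l ++ greedyDigits U m c) := by
    refine ((hblock _ hg (by omega)).2 (by rwa [hval, hlen])).2 ?_
    have := hT 0 (Nat.zero_le _)
    rw [hsplit, deltaSum_zero] at this
    rw [hval, hlen]
    linarith
  have hlen1 : (digitBlock β 0 l ++ greedyDigits U m c).length = m + l := by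
    rw [List.length_append, length_digitBlock, hlen, Nat.add_comm]
  have hval1 : (val U (digitBlock β 0 l ++ greedyDigits U m c) : ℤ) =
      U (m + l) - Delta U β l (m + l) + c := by
    rw [val_append, hlen, hval, Delta_add_eq]
    push_cast
    ring
  refine IsGreedy.eq_topWord hU ((isGreedy_wordPow_append_iff hU hβ hl
    (fun v hv hm => (hblock v hv hm).1) j h1 (by omega)).2 fun s hs => ?_) ?_ ?_
  · have := hT s hs
    rw [hsplit] at this
    rw [hval1, hlen1]
    linarith
  · rw [List.length_append, hlen1, length_wordPow, length_quasiBlock (hl.pos hβ)]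
    ring
  · have h2 := val_wordPow_append (U := U) hβ hl j (digitBlock β 0 l ++ greedyDigits U m c)
    rw [hsplit] at hTj
    rw [hval1, hlen1, show m + l + j * l = m + (j + 1) * l by ring] at h2
    have := hU.pos (m + (j + 1) * l)
    omega

theorem topWord_eq_of_deltaSum_eq_zero {U : ℕ → ℕ} (hU : IsPositionalSystem U) {β : ℝ}
    (hβ : 1 ≤ β) {l : ℕ} (hl : IsFiniteOfLength (digit β) l) {m₀ : ℕ}
    (hblock : ∀ v, IsGreedy U v → m₀ ≤ v.length → (IsGreedy U (quasiBlock β l ++ v) ↔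
      (val U v : ℤ) < U v.length + Delta U β l (v.length + l)))
    {m j : ℕ} (hm : m₀ ≤ m) (hT : ∀ s ≤ j, 0 ≤ deltaSum U β l s m)
    (hTj : deltaSum U β l j m = 0) :
    topWord U (m + j * l) = wordPow (quasiBlock β l) j ++ topWord U m := by
  have hlen := length_topWord U m
  have hval := val_topWord hU m
  have hpos := hU.pos m
  refine IsGreedy.eq_topWord hU ((isGreedy_wordPow_append_iff hU hβ hl hblock j
    (isGreedy_topWord hU m) (by omega)).2 fun s hs => ?_) ?_ ?_
  · have := hT s hs
    rw [hlen, hval]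
    omega
  · rw [List.length_append, hlen, length_wordPow, length_quasiBlock (hl.pos hβ), Nat.add_comm]
  · have h2 := val_wordPow_append (U := U) hβ hl j (topWord U m)
    rw [hlen, hval, hTj] at h2
    have := hU.pos (m + j * l)
    omega

/-- If `Δ` is ultimately periodic with nonnegative cycle sums, the greedy words of largest value
are obtained from one another by inserting zeros or a fixed prefix. -/
theorem exists_topWord_structure {U : ℕ → ℕ} (hU : IsPositionalSystem U) {β : ℝ}
    (hβ : 1 ≤ β) (hroot : HasDominantRoot U β) {l : ℕ} (hl : IsFiniteOfLength (digit β) l)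
    {N M' : ℕ} (h : HasPreperiodPeriod (Delta U β l) N (M' * l))
    (hc : ∀ m, N ≤ m + l → 0 ≤ deltaSum U β l M' m) :
    ∃ N₀ I, M' * l ≤ N₀ ∧ ∀ n ≥ N₀,
      (∃ (p z : List ℕ) (a : ℕ), p.length ≤ M' * l ∧ z.length ≤ I ∧
        topWord U n = p ++ (List.replicate a 0 ++ z) ∧
        topWord U (n + M' * l) = p ++ (List.replicate (a + M' * l) 0 ++ z)) ∨
      ∃ g : List ℕ, g.length = M' * l ∧ topWord U n = g ++ topWord U (n - M' * l) ∧
        topWord U (n + M' * l) = g ++ topWord U n := by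
  obtain ⟨ε, hε, m₀, hblock⟩ := exists_isGreedy_block_iff hU hβ hroot hl
  have hpos := hl.pos hβ
  set M := M' * l with hM
  set C : ℤ := ∑ j ∈ Finset.range M', ∑ m ∈ Finset.range (N + M),
    |deltaSum U β l (j + 1) m| with hC
  have hCb : ∀ m j, j < M' → deltaSum U β l (j + 1) m ≤ C := by
    intro m j hj
    induction m using Nat.strong_induction_on with
    | _ m ih =>
      by_cases hm : m < N + M
      · refine (le_abs_self _).trans (le_trans ?_ (Finset.single_le_sum
          (f := fun j => ∑ m ∈ Finset.range (N + M), |deltaSum U β l (j + 1) m|)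
          (fun _ _ => Finset.sum_nonneg fun _ _ => abs_nonneg _) (Finset.mem_range.2 hj)))
        exact Finset.single_le_sum (f := fun m => |deltaSum U β l (j + 1) m|)
          (fun _ _ => abs_nonneg _) (Finset.mem_range.2 hm)
      · have hM0 : 0 < M := h.1
        have := ih (m - M) (by omega)
        rwa [← deltaSum_add_period h _ (by omega), Nat.sub_add_cancel (by omega)] at this
  -- From length `I` on, every remainder c ≤ C fits and is small enough to follow d.
  obtain ⟨I, hI⟩ := eventually_atTop.1 ((hU.tendsto_atTop.eventually_gt_atTop C.toNat).and
    ((tendsto_natCast_atTop_atTop (R := ℝ)).comp hU.tendsto_atTop |>.eventually_ge_atTop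
      ((C.toNat : ℝ) / ε)))
  refine ⟨N + M + m₀ + I, I, by omega, fun n hn => ?_⟩
  -- Either some sum of Δ ending at `n` is positive within one cycle, or the full cycle sum, being
  -- nonnegative, is 0.
  by_cases hex : ∃ j, j < M' ∧ 1 ≤ deltaSum U β l (j + 1) (n - (j + 1) * l)
  · classical
    left
    set j := Nat.find hex with hj
    obtain ⟨hjM, hj1⟩ := Nat.find_spec hex
    rw [← hj] at hjM hj1
    have hjl : (j + 1) * l ≤ M := Nat.mul_le_mul_right l hjM
    obtain ⟨m, hmn⟩ : ∃ m, n = m + (j + 1) * l := ⟨n - (j + 1) * l, by omega⟩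
    rw [hmn, Nat.add_sub_cancel] at hj1
    obtain ⟨c, hcm⟩ := Int.eq_ofNat_of_zero_le
      (show 0 ≤ deltaSum U β l (j + 1) m - 1 by omega)
    have hTj : deltaSum U β l (j + 1) m = c + 1 := by linarith
    -- Minimality of `j` makes the later part of the sum, after its first s + 1 terms, nonpositive.
    have hT : ∀ s ≤ j, (c : ℤ) < deltaSum U β l (s + 1) m := by
      intro s hs
      rcases Nat.eq_or_lt_of_le hs with rfl | hs
      · omega
      · obtain ⟨i, hi⟩ : ∃ i, j = s + 1 + i := ⟨j - (s + 1), by omega⟩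
        have h1 := Nat.find_min hex (m := i) (by omega)
        have h2 : n - (i + 1) * l = m + (s + 1) * l := by
          have : (j + 1) * l = (s + 1) * l + (i + 1) * l := by rw [hi]; ring
          omega
        rw [h2] at h1
        have h3 : deltaSum U β l (i + 1) (m + (s + 1) * l) ≤ 0 := by
          by_contra! h4
          exact h1 ⟨by omega, h4⟩
        rw [hi, add_assoc, deltaSum_add] at hTj
        linarith
    have hcC : c ≤ C.toNat := by
      have := hCb m j hjM
      omega
    have hmI : I ≤ m := by omega
    have hcU : ∀ m ≥ I, c < U m ∧ (c : ℝ) ≤ ε * U m := by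
      intro m hm
      obtain ⟨h1, h2⟩ := hI m hm
      refine ⟨by omega, ?_⟩
      rw [Function.comp, div_le_iff₀ hε] at h2
      have : (c : ℝ) ≤ C.toNat := by exact_mod_cast hcC
      linarith
    have hzero : ∀ a, greedyDigits U (a + I) c =
        List.replicate a 0 ++ greedyDigits U I c := fun a =>
      greedyDigits_eq_replicate_append hU (hcU I le_rfl).1 a
    have hpre : ∀ m', m' ≥ m → (∀ s, deltaSum U β l s m' = deltaSum U β l s m) →
        topWord U (m' + (j + 1) * l) = (wordPow (quasiBlock β l) j ++ digitBlock β 0 l) ++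
          (List.replicate (m' - I) 0 ++ greedyDigits U I c) := by
      intro m' hm' hs
      rw [topWord_eq_of_deltaSum_eq_succ hU hβ hl hblock (by omega) (hcU m' (by omega)).1
        (hcU m' (by omega)).2 (fun s hsj => by rw [hs]; exact hT s hsj) (by rw [hs, hTj]),
        ← hzero, Nat.sub_add_cancel (by omega), List.append_assoc]
    refine ⟨wordPow (quasiBlock β l) j ++ digitBlock β 0 l, greedyDigits U I c, m - I, ?_,
      (length_greedyDigits U I c).le, ?_, ?_⟩
    · rw [List.length_append, length_wordPow, length_digitBlock, length_quasiBlock hpos]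
      linarith
    · rw [hmn]
      exact hpre m le_rfl fun _ => rfl
    · rw [hmn, Nat.add_right_comm, hpre (m + M) (by omega)
        fun s => deltaSum_add_period h s (by omega), Nat.sub_add_comm hmI]
  · right
    push Not at hex
    obtain ⟨m, hmn⟩ : ∃ m, n = m + M := ⟨n - M, by omega⟩
    have hM1 : 0 < M' := Nat.pos_of_mul_pos_right h.1
    have hTM : deltaSum U β l M' m = 0 := by
      have h1 := hex (M' - 1) (by omega)
      rw [Nat.sub_add_cancel hM1, ← hM, hmn, Nat.add_sub_cancel] at h1
      have := hc m (by omega)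
      omega
    have hT : ∀ s ≤ M', 0 ≤ deltaSum U β l s m := by
      intro s hs
      rcases Nat.eq_or_lt_of_le hs with rfl | hs
      · exact hTM.ge
      · obtain ⟨i, hi⟩ : ∃ i, M' = s + (i + 1) := ⟨M' - s - 1, by omega⟩
        have h1 := hex i (by omega)
        have h2 : n - (i + 1) * l = m + s * l := by
          have : M = s * l + (i + 1) * l := by rw [hM, hi]; ring
          omega
        rw [h2] at h1
        have h3 : deltaSum U β l (s + (i + 1)) m = 0 := by rw [← hi, hTM]
        rw [deltaSum_add] at h3
        linarith
    have hper := fun s => deltaSum_add_period h s (m := m) (by omega)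
    refine ⟨wordPow (quasiBlock β l) M', by rw [length_wordPow, length_quasiBlock hpos], ?_, ?_⟩
    · rw [hmn, Nat.add_sub_cancel]
      exact topWord_eq_of_deltaSum_eq_zero hU hβ hl (fun v hv hm => (hblock v hv hm).1)
        (by omega) hT hTM
    · rw [hmn]
      exact topWord_eq_of_deltaSum_eq_zero hU hβ hl (fun v hv hm => (hblock v hv hm).1)
        (by omega) (fun s hs => by rw [hper]; exact hT s hs) (by rw [hper, hTM])

theorem isRegular_of_deltaSum_nonneg {U : ℕ → ℕ} (hU : IsPositionalSystem U) {β : ℝ}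
    (hβ : 1 ≤ β) (hroot : HasDominantRoot U β) {l : ℕ} (hl : IsFiniteOfLength (digit β) l)
    {N M' : ℕ} (h : HasPreperiodPeriod (Delta U β l) N (M' * l))
    (hc : ∀ m, N ≤ m + l → 0 ≤ deltaSum U β l M' m) :
    (numerationLanguage U).IsRegular := by
  obtain ⟨N₀, I, hN₀, hstr⟩ := exists_topWord_structure hU hβ hroot hl h hc
  have hM0 : 0 < M' * l := h.1
  set M := M' * l with hM
  -- With i ≥ I the first `k` letters never reach `z`; with k ≥ N₀ ≥ M the deleted letters cover `p`
  -- or `g`.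
  refine isRegular_of_topWord hU (p := M) (I := N₀ + I) (X := N₀) hM0 ?_ ?_
  · intro i k hi
    induction k using Nat.strong_induction_on with
    | _ k ih =>
      rcases hstr (k + i) (by omega) with ⟨p, z, a, hp, hz, h1, h2⟩ | ⟨g, hg, h1, h2⟩
      · have hk : k ≤ (p ++ List.replicate a 0).length := by
          have := congrArg List.length h1
          rw [length_topWord] at this
          simp only [List.length_append] at this ⊢
          omega
        rw [← Nat.add_assoc, h1, h2, List.replicate_add, ← List.append_assoc, ← List.append_assoc,
          ← List.append_assoc, List.append_assoc (p ++ _), List.take_append_of_le_length hk,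
          List.take_append_of_le_length hk]
      · rw [← Nat.add_assoc]
        rcases Nat.le_total k M with hk | hk
        · rw [h2, h1, List.take_append_of_le_length (by omega),
            List.take_append_of_le_length (by omega)]
        · have htake : ∀ w, (g ++ w).take k = g ++ w.take (k - M) := fun w => by
            rw [List.take_append, hg, List.take_of_length_le (by omega)]
          -- Removing the common prefix `g` leaves the same question for prefixes of length k - M.
          have h3 := ih (k - M) (by omega)
          rw [show k - M + (i + M) = k + i by omega,
            show k - M + i = k + i - M by omega] at h3
          rw [h2, htake, h3, ← htake, ← h1]
  · intro i k hk
    rcases hstr (k + i) (by omega) with ⟨p, z, a, hp, hz, h1, h2⟩ | ⟨g, hg, h1, h2⟩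
    · obtain ⟨d, rfl⟩ : ∃ d, k = p.length + d := ⟨k - p.length, by omega⟩
      have hrep : List.replicate (a + M) 0 ++ z =
          List.replicate M 0 ++ (List.replicate a 0 ++ z) := by
        rw [Nat.add_comm, List.replicate_add, List.append_assoc]
      have hdrop := List.drop_length_add_append (l₁ := List.replicate M 0)
        (l₂ := List.replicate a 0 ++ z) d
      rw [List.length_replicate] at hdrop
      rw [show p.length + d + M + i = p.length + d + i + M by omega, h1, h2, Nat.add_assoc, List.drop_length_add_append,
        List.drop_length_add_append, hrep, Nat.add_comm d, hdrop]
    · rw [Nat.add_right_comm, h2, List.drop_append, hg, List.drop_eq_nil_of_le (by omega),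
        Nat.add_sub_cancel]
      rfl

end PosNum

theorem mainTheorem11 (U : ℕ → ℕ) (hU : PosNum.IsPositionalSystem U)
    (β : ℝ) (hβ : 1 ≤ β) (hroot : PosNum.HasDominantRoot U β)
    (l : ℕ) (hl : PosNum.IsFiniteOfLength (PosNum.digit β) l) :
    ((PosNum.numerationLanguage U).IsRegular →
        ∃ N M : ℕ, l ≤ N ∧ PosNum.HasPreperiodPeriod (PosNum.Delta U β l) N M) ∧
    (∀ N M M' : ℕ, l ≤ N → 1 ≤ M' → M = M' * l →
        PosNum.HasPreperiodPeriod (PosNum.Delta U β l) N M →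
        ((PosNum.numerationLanguage U).IsRegular ↔
          ∀ n ∈ Finset.Icc (N + M - l) (N + M - 1),
            0 ≤ ∑ j ∈ Finset.range M', PosNum.Delta U β l (n - j * l))) := by
  refine ⟨PosNum.exists_period_Delta hU hβ hroot hl, ?_⟩
  rintro N _ M' hN hM' rfl h
  rw [PosNum.sum_Delta_nonneg_iff (hl.pos hβ) hN hM' h]
  exact ⟨fun hreg m hm => PosNum.deltaSum_nonneg_of_isRegular hU hβ hroot hl h hreg hm,
    PosNum.isRegular_of_deltaSum_nonneg hU hβ hroot hl h⟩
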